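/- Fix a finite set $\pi$ of colour names. A \emph{PF-graph} (with palette $\pi$) is a finite directed graph $X$ with edge relation $E$ in which every vertex has at most one outgoing edge, together with the unary relation $\mathrm{Orphan}$ consisting of the vertices without outgoing edges and, for every colour name in $\pi$, a unary relation on the vertices. A \emph{function graph} is a PF-graph in which every vertex has exactly one outgoing edge. The \emph{Boolean associate} $\mathcal B(X)$ of a PF-graph $X$ is the Boolean algebra (with operations $0,1,\bar{\ },\cap,\cup$) of all sets of vertices of $X$, a vertex $x$ being identified with the atom $\{x\}$, together with the relations of $X$ ($E$, $\mathrm{Orphan}$ and the colours) as relations on the atoms of $\mathcal B(X)$, and an additional unary relation $\mathrm{Atomic}$ consisting of the atoms. For a first-order structure $M$ and $x_1,\dots,x_j\in M$, the \emph{$0$-theory} $th^0(M,x_1,\dots,x_j)$ is the set of atomic formulas $\varphi(v_1,\dots,v_j)$ (equalities of terms included) with $M\models\varphi(x_1,\dots,x_j)$, and the \emph{$(d+1)$-theory} is $th^{d+1}(M,x_1,\dots,x_j)=\{\,th^d(M,x_1,\dots,x_j,y) : y\in M\,\}$. The \emph{MSO $d$-theory} of a PF-graph $X$ is $Th^d(X)=th^d(\mathcal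 B(X))$. \textbf{Lemma.} There exists a computable function $F:\mathbb N\to\mathbb N$ (which may depend on the palette $\pi$) such that, for every $d\in\mathbb N$ and every function graph $X$ with palette $\pi$, there is a function graph $Y$ with palette $\pi$ and at most $F(d)$ vertices such that $Th^d(X)=Th^d(Y)$. -/

import Mathlib

universe u v w

/-- A coloured partial-function graph with palette `π` on the vertex type `V`: a directed graph in
which every vertex has at most one outgoing edge, together with one unary relation (a set of
vertices) for each colour. The unary relation `Orphan` is determined by the edges, see
`PFGraph.orphan`. -/
structure PFGraph (π : Type*) (V : Type*) extends Digraph V where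
  adj_unique : ∀ x y z : V, Adj x y → Adj x z → y = z
  color : π → Set V

/-- The unary relation `Orphan`: the vertices without outgoing edges. -/
def PFGraph.orphan {π V : Type*} (X : PFGraph π V) : Set V :=
  {x | ∀ y, ¬ X.Adj x y}

/-- A function graph is a partial-function graph where every vertex has exactly one outgoing
edge. -/
def PFGraph.IsFunctionGraph {π V : Type*} (X : PFGraph π V) : Prop :=
  ∀ x, ∃! y, X.Adj x y

/-- The operation symbols of Boolean algebras. -/
inductive BoolAssocFunctions : ℕ → Type
  | bot : BoolAssocFunctions 0
  | top : BoolAssocFunctions 0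
  | compl : BoolAssocFunctions 1
  | inf : BoolAssocFunctions 2
  | sup : BoolAssocFunctions 2

/-- The relation symbols of Boolean associates: the symbols `Orphan`, `E` and the colours of the
vocabulary of partial-function graphs, and the additional unary symbol `Atomic`. -/
inductive BoolAssocRelations (π : Type*) : ℕ → Type _
  | atomic : BoolAssocRelations π 1
  | orphan : BoolAssocRelations π 1
  | color (c : π) : BoolAssocRelations π 1
  | edge : BoolAssocRelations π 2

/-- The first-order vocabulary of Boolean associates of partial-function graphs. -/
def boolAssocLanguage (π : Type*) : FirstOrder.Language :=
  ⟨BoolAssocFunctions, BoolAssocRelations π⟩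

/-- The carrier of the Boolean associate of `X`: the Boolean algebra of all sets of vertices, a
vertex `x` being identified with the atom `{x}`. -/
def PFGraph.BoolAssoc {π V : Type*} (_X : PFGraph π V) : Type _ := Set V

instance PFGraph.boolAssocBooleanAlgebra {π V : Type*} (X : PFGraph π V) :
    BooleanAlgebra X.BoolAssoc :=
  inferInstanceAs (BooleanAlgebra (Set V))

/-- The Boolean associate of `X` as a first-order structure: the Boolean operations, the relations
of `X` transported to the atoms, and the set of all atoms. -/
instance PFGraph.boolAssocStructure {π V : Type*} (X : PFGraph π V) :
    (boolAssocLanguage π).Structure X.BoolAssoc where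
  funMap {n} f a :=
    match n, f, a with
    | _, BoolAssocFunctions.bot, _ => ⊥
    | _, BoolAssocFunctions.top, _ => ⊤
    | _, BoolAssocFunctions.compl, a => (a 0)ᶜ
    | _, BoolAssocFunctions.inf, a => a 0 ⊓ a 1
    | _, BoolAssocFunctions.sup, a => a 0 ⊔ a 1
  RelMap {n} R a :=
    match n, R, a with
    | _, BoolAssocRelations.atomic, a => ∃ x : V, a 0 = ({x} : Set V)
    | _, BoolAssocRelations.orphan, a => ∃ x ∈ X.orphan, a 0 = ({x} : Set V)
    | _, BoolAssocRelations.color c, a => ∃ x ∈ X.color c, a 0 = ({x} : Set V)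
    | _, BoolAssocRelations.edge, a =>
        ∃ x y : V, X.Adj x y ∧ a 0 = ({x} : Set V) ∧ a 1 = ({y} : Set V)

/-- The type of possible `d`-theories of `j`-tuples in the vocabulary `L`: sets of formulas in `j`
variables for `d = 0`, and sets of `d`-theories of `(j + 1)`-tuples for `d + 1`. -/
def FiniteTheory (L : FirstOrder.Language.{u, v}) : ℕ → ℕ → Type (max u v)
  | 0, j => Set (L.Formula (Fin j))
  | d + 1, j => Set (FiniteTheory L d (j + 1))

/-- The first-order `d`-theory `th^d(M, x₁, …, x_j)`: for `d = 0` it is the set of atomic formulas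
true at the tuple, and the `(d + 1)`-theory is the set of the `d`-theories of all extensions of the
tuple by one element of `M`. -/
def finiteTheory (L : FirstOrder.Language.{u, v}) {M : Type w} [L.Structure M] :
    (d : ℕ) → {j : ℕ} → (Fin j → M) → FiniteTheory L d j
  | 0, j, x => ({φ | φ.IsAtomic ∧ φ.Realize x} : Set (L.Formula (Fin j)))
  | d + 1, j, x =>
      (Set.range fun y : M => finiteTheory L d (Fin.snoc (α := fun _ => M) x y) :
        Set (FiniteTheory L d (j + 1)))

/-- The MSO `d`-theory of a partial-function graph: the first-order `d`-theory of its Boolean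
associate (with no distinguished elements). -/
def PFGraph.msoTheory {π V : Type*} (X : PFGraph π V) (d : ℕ) :
    FiniteTheory (boolAssocLanguage π) d 0 :=
  finiteTheory (boolAssocLanguage π) d (Fin.elim0 : Fin 0 → X.BoolAssoc)

/-!
A disjoint union of two coloured graphs, with edges added between the parts according to colours
only, has a theory determined by the theories of the parts. Hence the set of `d`-theories of graphs
with at most `2 ^ k` vertices is closed under such gluings as soon as it is the same for `k` and
`k + 1`, which happens for some `k` at most the number of `d`-theories. Every finite function graph
is glued from single vertices with a fixed number of colours: a forest by splitting off the tree of
a root and then removing the root, a component with a cycle by removing a vertex `r` of the cycle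
from it and marking its successor `f r`. So some graph of bounded size has the same theory. That it
is again a function graph is read off from its `2`-theory, which is why depth `d + 2` is used.
-/

theorem exists_eq_succ_of_monotone {T : Type*} [Finite T] {A : ℕ → Set T} (hA : Monotone A) :
    ∃ k ≤ Nat.card T, A k = A (k + 1) := by
  by_contra! h
  have le_ncard : ∀ k ≤ Nat.card T + 1, k ≤ (A k).ncard := by
    intro k hk
    induction k with
    | zero => exact Nat.zero_le _
    | succ k ih =>
      have : (A k).ncard < (A (k + 1)).ncard :=
        Set.ncard_lt_ncard ((hA k.le_succ).ssubset_of_ne (h k (by lia)))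
      have := ih (by lia)
      lia
  have := le_ncard _ le_rfl
  have := Set.ncard_le_card (A (Nat.card T + 1))
  lia

/-- A directed graph whose vertices are coloured by elements of `C`. A tuple of sets of vertices is
encoded by the colouring that records which of the sets a vertex belongs to. -/
structure ColoredDigraph (V : Type*) (C : Type*) extends Digraph V where
  color : V → C

namespace ColoredDigraph

variable {V : Type v} {W : Type w} {C C' : Type u}

/-- The graph `G` with one more distinguished set of vertices `A`. -/
def expand (G : ColoredDigraph V C) (A : Set V) : ColoredDigraph V (C × Prop) where
  Adj := G.Adj
  color x := (G.color x, x ∈ A)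

/-- The graph `G` with its colours renamed, and possibly identified, by `g`. -/
def recolor (G : ColoredDigraph V C) (g : C → C') : ColoredDigraph V C' where
  Adj := G.Adj
  color x := g (G.color x)

/-- The pullback of a graph along a map into its vertices; induced subgraphs are the pullbacks along
subtype inclusions. -/
def comap (G : ColoredDigraph W C) (e : V → W) : ColoredDigraph V C where
  Adj x y := G.Adj (e x) (e y)
  color x := G.color (e x)

/-- The type of possible monadic `d`-theories of graphs coloured by `C`. -/
def Theory : ℕ → Type u → Type u
  | 0, C => Set (C × C × Prop × Prop)
  | d + 1, C => Set (Theory d (C × Prop))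

/-- The monadic `d`-theory of a coloured graph. The `0`-theory consists of the quantifier-free types
of pairs of vertices, and the `(d + 1)`-theory of the `d`-theories of all expansions by a set of
vertices. -/
def theory : (d : ℕ) → {C : Type u} → ColoredDigraph V C → Theory d C
  | 0, C, G =>
    (Set.range fun p : V × V => (G.color p.1, G.color p.2, p.1 = p.2, G.Adj p.1 p.2) :
      Set (C × C × Prop × Prop))
  | d + 1, C, G => (Set.range fun A : Set V => (G.expand A).theory d : Set (Theory d (C × Prop)))

/-- Every quantifier-free type of a pair of vertices of `G` is realized in `H`: the forth condition
of back-and-forth at depth `0`. -/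
def PairForth (G : ColoredDigraph V C) (H : ColoredDigraph W C) : Prop :=
  ∀ x y, ∃ x' y', H.color x' = G.color x ∧ H.color y' = G.color y ∧
    (x' = y' ↔ x = y) ∧ (H.Adj x' y' ↔ G.Adj x y)

section Theory

variable {d : ℕ} {G : ColoredDigraph V C} {H : ColoredDigraph W C}

theorem theory_zero_eq_iff : G.theory 0 = H.theory 0 ↔ G.PairForth H ∧ H.PairForth G := by
  change (Set.range _ : Set (C × C × Prop × Prop)) = Set.range _ ↔ _
  simp only [Set.Subset.antisymm_iff, Set.range_subset_iff, Set.mem_range, Prod.forall,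
    Prod.exists, Prod.mk.injEq, eq_iff_iff, PairForth]

theorem theory_succ_eq_iff :
    G.theory (d + 1) = H.theory (d + 1) ↔
      (∀ A, ∃ B, (G.expand A).theory d = (H.expand B).theory d) ∧
        ∀ B, ∃ A, (G.expand A).theory d = (H.expand B).theory d := by
  change (Set.range _ : Set (Theory d (C × Prop))) = Set.range _ ↔ _
  simp only [Set.Subset.antisymm_iff, Set.range_subset_iff, Set.mem_range, eq_comm]

theorem theory_comap_equiv (d : ℕ) {C : Type u} (G : ColoredDigraph W C) (e : V ≃ W) :
    (G.comap e).theory d = G.theory d := by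
  induction d generalizing C with
  | zero =>
    refine theory_zero_eq_iff.2 ⟨fun x y => ⟨e x, e y, rfl, rfl, e.apply_eq_iff_eq, Iff.rfl⟩,
      fun x y => ⟨e.symm x, e.symm y, ?_⟩⟩
    simp [comap]
  | succ d ih =>
    have expand_comap (B : Set W) : ((G.comap e).expand (e ⁻¹' B)).theory d =
        (G.expand B).theory d := ih (G.expand B)
    refine theory_succ_eq_iff.2 ⟨fun A => ⟨e.symm ⁻¹' A, ?_⟩, fun B => ⟨e ⁻¹' B, expand_comap B⟩⟩
    rw [← expand_comap, e.preimage_symm_preimage]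

theorem expand_recolor (G : ColoredDigraph V C) (g : C → C') (A : Set V) :
    (G.recolor g).expand A = (G.expand A).recolor (Prod.map g id) :=
  rfl

theorem PairForth.recolor (h : G.PairForth H) (g : C → C') :
    (G.recolor g).PairForth (H.recolor g) := fun x y =>
  let ⟨x', y', hx, hy, heq, hadj⟩ := h x y
  ⟨x', y', congrArg g hx, congrArg g hy, heq, hadj⟩

theorem PairForth.eq_of_color_eq (h : H.PairForth G) {s t : Set V} {s' t' : Set W}
    (hs : ∀ x y, G.color x = H.color y → (x ∈ s ↔ y ∈ s'))
    (ht : ∀ x y, G.color x = H.color y → (x ∈ t ↔ y ∈ t')) (hst : s = t) : s' = t' := by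
  ext y
  obtain ⟨x, -, hxy, -⟩ := h y y
  rw [← hs x y hxy, ← ht x y hxy, hst]

theorem PairForth.eq_singleton_of_color_eq (h : H.PairForth G) {s : Set V}
    {s' : Set W} (hs : ∀ x y, G.color x = H.color y → (x ∈ s ↔ y ∈ s')) {x : V} {y : W}
    (hxy : G.color x = H.color y) (hx : s = {x}) : s' = {y} := by
  subst hx
  refine Set.eq_singleton_iff_unique_mem.2 ⟨(hs x y hxy).1 rfl, fun z hz => ?_⟩
  obtain ⟨x₁, x₂, hx₁, hx₂, heq, -⟩ := h z y
  exact heq.1 (((hs x₁ z hx₁).2 hz).trans ((hs x₂ y hx₂).2 ((hs x y hxy).1 rfl)).symm)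

theorem theory_recolor_eq {C C' : Type u} {G : ColoredDigraph V C} {H : ColoredDigraph W C}
    (h : G.theory d = H.theory d) (g : C → C') :
    (G.recolor g).theory d = (H.recolor g).theory d := by
  induction d generalizing C C' with
  | zero =>
    obtain ⟨hGH, hHG⟩ := theory_zero_eq_iff.1 h
    exact theory_zero_eq_iff.2 ⟨hGH.recolor g, hHG.recolor g⟩
  | succ d ih =>
    obtain ⟨forth, back⟩ := theory_succ_eq_iff.1 h
    simp only [theory_succ_eq_iff, expand_recolor]
    exact ⟨fun A => (forth A).imp fun _ hAB => ih hAB _,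
      fun B => (back B).imp fun _ hAB => ih hAB _⟩

theorem theory_eq_of_le {k : ℕ} (hkd : k ≤ d) (h : G.theory d = H.theory d) :
    G.theory k = H.theory k := by
  induction d, hkd using Nat.le_induction with
  | base => exact h
  | succ d _ ih =>
    obtain ⟨B, hB⟩ := (theory_succ_eq_iff.1 h).1 ∅
    exact ih (theory_recolor_eq hB Prod.fst)

end Theory

section Glue

universe v₁ v₂ w₁ w₂

variable {V₁ : Type v₁} {V₂ : Type v₂} {W₁ : Type w₁} {W₂ : Type w₂} {C₁ C₂ : Type u}

/-- The disjoint union of two coloured graphs, with edges from left to right between the pairs of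
colours in `R` and from right to left between those in `S`, recoloured by `g₁` and `g₂`. -/
def glue (G₁ : ColoredDigraph V₁ C₁) (G₂ : ColoredDigraph V₂ C₂) (R : C₁ → C₂ → Prop)
    (S : C₂ → C₁ → Prop) (g₁ : C₁ → C) (g₂ : C₂ → C) : ColoredDigraph (V₁ ⊕ V₂) C where
  Adj
    | .inl x, .inl y => G₁.Adj x y
    | .inl x, .inr y => R (G₁.color x) (G₂.color y)
    | .inr x, .inl y => S (G₂.color x) (G₁.color y)
    | .inr x, .inr y => G₂.Adj x y
  color := Sum.elim (g₁ ∘ G₁.color) (g₂ ∘ G₂.color)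

theorem expand_glue (G₁ : ColoredDigraph V₁ C₁) (G₂ : ColoredDigraph V₂ C₂) (R : C₁ → C₂ → Prop)
    (S : C₂ → C₁ → Prop) (g₁ : C₁ → C) (g₂ : C₂ → C) (A : Set (V₁ ⊕ V₂)) :
    (glue G₁ G₂ R S g₁ g₂).expand A =
      glue (G₁.expand (Sum.inl ⁻¹' A)) (G₂.expand (Sum.inr ⁻¹' A)) (fun a b => R a.1 b.1)
        (fun b a => S b.1 a.1) (Prod.map g₁ id) (Prod.map g₂ id) := by
  simp only [expand, glue, mk.injEq, true_and]
  funext x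
  rcases x with x | x <;> rfl

theorem PairForth.glue {G₁ : ColoredDigraph V₁ C₁} {G₂ : ColoredDigraph V₂ C₂}
    {H₁ : ColoredDigraph W₁ C₁} {H₂ : ColoredDigraph W₂ C₂} (h₁ : G₁.PairForth H₁)
    (h₂ : G₂.PairForth H₂) (R : C₁ → C₂ → Prop) (S : C₂ → C₁ → Prop) (g₁ : C₁ → C) (g₂ : C₂ → C) :
    (glue G₁ G₂ R S g₁ g₂).PairForth (glue H₁ H₂ R S g₁ g₂) := by
  rintro (x | x) (y | y)
  · obtain ⟨x', y', hx, hy, heq, hadj⟩ := h₁ x y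
    exact ⟨.inl x', .inl y', by simp_all [ColoredDigraph.glue]⟩
  · obtain ⟨x', -, hx, -⟩ := h₁ x x
    obtain ⟨y', -, hy, -⟩ := h₂ y y
    exact ⟨.inl x', .inr y', by simp_all [ColoredDigraph.glue]⟩
  · obtain ⟨x', -, hx, -⟩ := h₂ x x
    obtain ⟨y', -, hy, -⟩ := h₁ y y
    exact ⟨.inr x', .inl y', by simp_all [ColoredDigraph.glue]⟩
  · obtain ⟨x', y', hx, hy, heq, hadj⟩ := h₂ x y
    exact ⟨.inr x', .inr y', by simp_all [ColoredDigraph.glue]⟩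

theorem theory_glue_eq {d : ℕ} {C C₁ C₂ : Type u} {G₁ : ColoredDigraph V₁ C₁}
    {G₂ : ColoredDigraph V₂ C₂} {H₁ : ColoredDigraph W₁ C₁} {H₂ : ColoredDigraph W₂ C₂}
    (h₁ : G₁.theory d = H₁.theory d) (h₂ : G₂.theory d = H₂.theory d) (R : C₁ → C₂ → Prop)
    (S : C₂ → C₁ → Prop) (g₁ : C₁ → C) (g₂ : C₂ → C) :
    (glue G₁ G₂ R S g₁ g₂).theory d = (glue H₁ H₂ R S g₁ g₂).theory d := by
  induction d generalizing C C₁ C₂ with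
  | zero =>
    obtain ⟨forth₁, back₁⟩ := theory_zero_eq_iff.1 h₁
    obtain ⟨forth₂, back₂⟩ := theory_zero_eq_iff.1 h₂
    exact theory_zero_eq_iff.2 ⟨forth₁.glue forth₂ R S g₁ g₂, back₁.glue back₂ R S g₁ g₂⟩
  | succ d ih =>
    obtain ⟨forth₁, back₁⟩ := theory_succ_eq_iff.1 h₁
    obtain ⟨forth₂, back₂⟩ := theory_succ_eq_iff.1 h₂
    simp only [theory_succ_eq_iff, expand_glue]
    constructor
    · intro A
      obtain ⟨B₁, hB₁⟩ := forth₁ (Sum.inl ⁻¹' A)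
      obtain ⟨B₂, hB₂⟩ := forth₂ (Sum.inr ⁻¹' A)
      refine ⟨Sum.inl '' B₁ ∪ Sum.inr '' B₂, ?_⟩
      simpa [Set.preimage_image_eq, Sum.inl_injective, Sum.inr_injective] using ih hB₁ hB₂ _ _ _ _
    · intro B
      obtain ⟨A₁, hA₁⟩ := back₁ (Sum.inl ⁻¹' B)
      obtain ⟨A₂, hA₂⟩ := back₂ (Sum.inr ⁻¹' B)
      refine ⟨Sum.inl '' A₁ ∪ Sum.inr '' A₂, ?_⟩
      simpa [Set.preimage_image_eq, Sum.inl_injective, Sum.inr_injective] using ih hA₁ hA₂ _ _ _ _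

end Glue

section Counting

/-- The number of elements of `Theory d C` when `C` has `n` elements: a tower of height `d + 1`. -/
def numTheories (d n : ℕ) : ℕ :=
  (2 ^ ·)^[d + 1] (4 * (n * 2 ^ d) ^ 2)

theorem numTheories_succ (d n : ℕ) : numTheories (d + 1) n = 2 ^ numTheories d (n * 2) := by
  rw [numTheories, Function.iterate_succ_apply', numTheories, pow_succ' 2 d, mul_assoc]

instance finite_theory (d : ℕ) : ∀ (C : Type u) [Finite C], Finite (Theory d C) := by
  induction d with
  | zero => exact fun C _ => inferInstanceAs (Finite (Set (C × C × Prop × Prop)))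
  | succ d ih => exact fun C _ => inferInstanceAs (Finite (Set (Theory d (C × Prop))))

theorem card_theory (d : ℕ) (C : Type u) [Finite C] :
    Nat.card (Theory d C) = numTheories d (Nat.card C) := by
  have card_set (α : Type u) [Finite α] : Nat.card (Set α) = 2 ^ Nat.card α := by
    have := Fintype.ofFinite α
    simp
  induction d generalizing C with
  | zero =>
    change Nat.card (Set (C × C × Prop × Prop)) = 2 ^ (4 * (Nat.card C * 2 ^ 0) ^ 2)
    rw [card_set]
    simp only [Nat.card_prod, Nat.card_eq_fintype_card (α := Prop), Fintype.card_prop]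
    ring
  | succ d ih =>
    change Nat.card (Set (Theory d (C × Prop))) = _
    rw [card_set, ih, numTheories_succ, Nat.card_prod, Nat.card_eq_fintype_card (α := Prop),
      Fintype.card_prop]

theorem primrec_numTheories (n : ℕ) : Primrec fun d => numTheories d n := by
  have primrec_pow : Primrec₂ ((· ^ ·) : ℕ → ℕ → ℕ) := Primrec₂.unpaired'.1 Nat.Primrec.pow
  have two_pow : Primrec (2 ^ · : ℕ → ℕ) := primrec_pow.comp (.const 2) .id
  have start : Primrec fun d => 4 * (n * 2 ^ d) ^ 2 :=
    Primrec.nat_mul.comp (.const 4)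
      (primrec_pow.comp (Primrec.nat_mul.comp (.const n) two_pow) (.const 2))
  exact Primrec.nat_iterate .succ start (two_pow.comp .snd).to₂

theorem computable_two_pow_numTheories (k n : ℕ) :
    Computable fun d => 2 ^ numTheories (d + k) n :=
  ((Primrec₂.unpaired'.1 Nat.Primrec.pow).comp (.const 2)
    ((primrec_numTheories n).comp (Primrec.nat_add.comp .id (.const k)))).to_comp

end Counting

section SmallTheories

/-- A set of `d`-theories that contains the theories of graphs with at most one vertex and is closed
under gluing. -/
structure IsGlueClosed (d : ℕ) (T : Set (Theory d C)) : Prop where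
  mem_of_subsingleton : ∀ {V : Type v} [Subsingleton V] (G : ColoredDigraph V C), G.theory d ∈ T
  glue_mem : ∀ {V₁ V₂ : Type v} {G₁ : ColoredDigraph V₁ C} {G₂ : ColoredDigraph V₂ C}
    (R S : C → C → Prop) (g₁ g₂ : C → C), G₁.theory d ∈ T → G₂.theory d ∈ T →
      (glue G₁ G₂ R S g₁ g₂).theory d ∈ T

/-- The `d`-theories of coloured graphs with at most `2 ^ k` vertices. -/
def smallTheories (d : ℕ) (C : Type u) (k : ℕ) : Set (Theory d C) :=
  {t | ∃ n ≤ 2 ^ k, ∃ G : ColoredDigraph (Fin n) C, G.theory d = t}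

theorem monotone_smallTheories (d : ℕ) (C : Type u) : Monotone (smallTheories d C) := by
  rintro k l hkl _ ⟨n, hn, G, rfl⟩
  exact ⟨n, hn.trans (Nat.pow_le_pow_right two_pos hkl), G, rfl⟩

theorem theory_mem_smallTheories {d k : ℕ} [Finite V] (hV : Nat.card V ≤ 2 ^ k)
    (G : ColoredDigraph V C) : G.theory d ∈ smallTheories d C k :=
  ⟨_, hV, G.comap (Finite.equivFin V).symm, theory_comap_equiv d G _⟩

theorem isGlueClosed_smallTheories {d k : ℕ}
    (hk : smallTheories d C k = smallTheories d C (k + 1)) :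
    IsGlueClosed.{u, v} d (smallTheories d C k) where
  mem_of_subsingleton G :=
    theory_mem_smallTheories (Finite.card_le_one_iff_subsingleton.2 ‹_› |>.trans
      Nat.one_le_two_pow) G
  glue_mem := by
    rintro V₁ V₂ G₁ G₂ R S g₁ g₂ ⟨n, hn, H₁, h₁⟩ ⟨m, hm, H₂, h₂⟩
    rw [hk, ← theory_glue_eq h₁ h₂]
    refine theory_mem_smallTheories ?_ _
    rw [Nat.card_sum, Nat.card_fin, Nat.card_fin, pow_succ]
    lia

theorem exists_isGlueClosed_smallTheories (d : ℕ) (C : Type u) [Finite C] :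
    ∃ k ≤ numTheories d (Nat.card C), IsGlueClosed.{u, v} d (smallTheories d C k) := by
  obtain ⟨k, hk, hstable⟩ := exists_eq_succ_of_monotone (monotone_smallTheories d C)
  exact ⟨k, card_theory d C ▸ hk, isGlueClosed_smallTheories hstable⟩

end SmallTheories

end ColoredDigraph

section Reachability

variable {V : Type*} {f : V → V} {S : Set V} {r x : V}

/-- `ReachesWithin f S r x` says that iterating `f` from `x` leads to `r` without leaving `S`. -/
inductive ReachesWithin (f : V → V) (S : Set V) (r : V) : V → Prop
  | root (hr : r ∈ S) : ReachesWithin f S r r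
  | step {x : V} (hx : x ∈ S) (h : ReachesWithin f S r (f x)) : ReachesWithin f S r x

/-- The set of all vertices that lead to `r` without leaving `S`. -/
def basin (f : V → V) (S : Set V) (r : V) : Set V :=
  {x | ReachesWithin f S r x}

theorem basin_subset (f : V → V) (S : Set V) (r : V) : basin f S r ⊆ S := by
  rintro x (h | ⟨h, -⟩) <;> exact h

theorem mem_basin_self (hr : r ∈ S) : r ∈ basin f S r :=
  ReachesWithin.root hr

theorem apply_mem_basin (hx : x ∈ basin f S r) (hxr : x ≠ r) : f x ∈ basin f S r := by
  rcases hx with h | ⟨-, h⟩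
  exacts [absurd rfl hxr, h]

theorem mem_basin_of_apply (hx : x ∈ S) (h : f x ∈ basin f S r) : x ∈ basin f S r :=
  ReachesWithin.step hx h

theorem mapsTo_sdiff_basin (hS : Set.MapsTo f S S) :
    Set.MapsTo f (S \ basin f S r) (S \ basin f S r) :=
  fun _ hx => ⟨hS hx.1, fun h => hx.2 (mem_basin_of_apply hx.1 h)⟩

theorem basin_sdiff_eq_empty_of_mapsTo {T : Set V} (hT : T ⊆ basin f S r \ {r})
    (hf : Set.MapsTo f T T) : T = ∅ := by
  refine Set.eq_empty_of_forall_notMem fun x hx => ?_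
  have hxr : ReachesWithin f S r x := (hT hx).1
  induction hxr with
  | root => exact (hT hx).2 rfl
  | step _ _ ih => exact ih (hf hx)

theorem exists_apply_mem_basin [Finite V] (hS : Set.MapsTo f S S) (hne : S.Nonempty) :
    ∃ r ∈ S, f r ∈ basin f S r := by
  obtain ⟨M, ⟨⟨r, hr⟩, hMS, hM⟩, hmin⟩ := wellFounded_lt.has_min
    {M : Set V | M.Nonempty ∧ M ⊆ S ∧ Set.MapsTo f M M} ⟨S, hne, subset_rfl, hS⟩
  refine ⟨r, hMS hr, by_contra fun h => hmin (M \ basin f S r) ⟨⟨f r, hM hr, h⟩,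
    Set.sdiff_subset.trans hMS, fun x hx => ?_⟩ ?_⟩
  · exact ⟨hM hx.1, fun hfx => hx.2 (mem_basin_of_apply (hMS hx.1) hfx)⟩
  · exact ⟨Set.sdiff_subset, fun hsub => (hsub hr).2 (mem_basin_self (hMS hr))⟩

end Reachability

namespace ColoredDigraph

variable {V : Type v} {K : Type u} {d : ℕ}

/-- The graph of the function `f`, coloured by `κ`. -/
def ofFun (f : V → V) (κ : V → K) : ColoredDigraph V K where
  Adj x y := f x = y
  color := κ

/-- The subgraph of the graph of `f` induced on `S`, where the colour of a vertex also records
whether its outgoing edge stays in `S`. -/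
def restrictFun (f : V → V) (κ : V → K) (S : Set V) : ColoredDigraph S (K × Prop) :=
  ((ofFun f κ).expand (f ⁻¹' S)).comap Subtype.val

variable {T : Set (Theory d (K × Prop))} {f : V → V} {κ : V → K} {S : Set V} {r : V}

theorem IsGlueClosed.restrictFun_union_mem (hT : IsGlueClosed.{u, v} d T) {S₁ S₂ : Set V}
    (hS : Disjoint S₁ S₂) (h₁₂ : ∀ x ∈ S₁, f x ∉ S₂) (h₂₁ : ∀ x ∈ S₂, f x ∉ S₁)
    (h₁ : (restrictFun f κ S₁).theory d ∈ T) (h₂ : (restrictFun f κ S₂).theory d ∈ T) :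
    (restrictFun f κ (S₁ ∪ S₂)).theory d ∈ T := by
  classical
  have glue_eq : (restrictFun f κ (S₁ ∪ S₂)).comap (Equiv.Set.union hS).symm =
      glue (restrictFun f κ S₁) (restrictFun f κ S₂) (fun _ _ => False) (fun _ _ => False)
        id id := by
    simp only [restrictFun, glue, comap, mk.injEq, Digraph.mk.injEq]
    constructor
    · ext (x | x) (y | y)
      · simp [expand, ofFun]
      · simpa [expand, ofFun] using fun h : f x = y => h₁₂ x x.2 (h ▸ y.2)
      · simpa [expand, ofFun] using fun h : f x = y => h₂₁ x x.2 (h ▸ y.2)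
      · simp [expand, ofFun]
    · ext (x | x)
      · rfl
      · simp [expand, ofFun, h₁₂ x x.2]
      · rfl
      · simp [expand, ofFun, h₂₁ x x.2]
  rw [← theory_comap_equiv d _ (Equiv.Set.union hS).symm, glue_eq]
  exact hT.glue_mem _ _ _ _ h₁ h₂

-- The colouring `κ'` may carry marks that `g` erases; `P` recovers the edge leaving `r` from them.
theorem IsGlueClosed.restrictFun_insert_mem (hT : IsGlueClosed.{u, v} d T) {κ' : V → K}
    (hr : r ∉ S) (hS : ∀ x ∈ S, f x ∈ insert r S) (g : K → K) (hκ : ∀ x ∈ S, κ x = g (κ' x))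
    (P : K → Prop) (hP : ∀ x ∈ S, f r = x ↔ P (κ' x))
    (h : (restrictFun f κ' S).theory d ∈ T) :
    (restrictFun f κ (insert r S)).theory d ∈ T := by
  classical
  have glue_eq : (restrictFun f κ (insert r S)).comap (Equiv.Set.insert hr).symm =
      glue (restrictFun f κ' S)
        ((restrictFun f κ (insert r S)).comap fun _ : PUnit => ⟨r, Set.mem_insert r S⟩)
        (fun a _ => ¬ a.2) (fun _ b => P b.1) (fun a => (g a.1, True)) id := by
    simp only [restrictFun, glue, comap, mk.injEq, Digraph.mk.injEq]
    constructor
    · ext (x | x) (y | y)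
      · simp [expand, ofFun]
      · simpa [expand, ofFun] using
          (⟨fun h => h ▸ hr, (hS x x.2).resolve_right⟩ : f x = r ↔ f x ∉ S)
      · simpa [expand, ofFun] using hP y y.2
      · simp [expand, ofFun]
    · ext (x | x)
      · exact hκ x x.2
      · simpa [expand, ofFun] using hS x x.2
      · rfl
      · rfl
  rw [← theory_comap_equiv d _ (Equiv.Set.insert hr).symm, glue_eq]
  exact hT.glue_mem _ _ _ _ h (hT.mem_of_subsingleton _)

theorem IsGlueClosed.restrictFun_mem_of_basin (hT : IsGlueClosed.{u, v} d T)
    (hfr : f r ∈ S → f r ∈ basin f S r) (hbasin : (restrictFun f κ (basin f S r)).theory d ∈ T)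
    (hrest : (restrictFun f κ (S \ basin f S r)).theory d ∈ T) :
    (restrictFun f κ S).theory d ∈ T := by
  rw [← Set.union_sdiff_cancel (basin_subset f S r)]
  refine hT.restrictFun_union_mem Set.disjoint_sdiff_right (fun x hx hfx => hfx.2 ?_)
    (fun x hx hfx => hx.2 (mem_basin_of_apply hx.1 hfx)) hbasin hrest
  obtain rfl | hxr := eq_or_ne x r
  exacts [hfr hfx.1, apply_mem_basin hx hxr]

theorem IsGlueClosed.restrictFun_basin_mem (hT : IsGlueClosed.{u, v} d T) {κ' : V → K}
    (hr : r ∈ S) (g : K → K) (hκ : ∀ x ∈ basin f S r \ {r}, κ x = g (κ' x))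
    (P : K → Prop) (hP : ∀ x ∈ basin f S r \ {r}, f r = x ↔ P (κ' x))
    (h : (restrictFun f κ' (basin f S r \ {r})).theory d ∈ T) :
    (restrictFun f κ (basin f S r)).theory d ∈ T := by
  have basin_eq : insert r (basin f S r \ {r}) = basin f S r := by
    rw [Set.insert_sdiff_singleton, Set.insert_eq_of_mem (mem_basin_self hr)]
  rw [← basin_eq]
  exact hT.restrictFun_insert_mem (by simp)
    (fun x hx => by rw [basin_eq]; exact apply_mem_basin hx.1 hx.2) g hκ P hP h

theorem IsGlueClosed.restrictFun_mem_of_acyclic [Finite V] (hT : IsGlueClosed.{u, v} d T)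
    (hS : ∀ M ⊆ S, Set.MapsTo f M M → M = ∅) : (restrictFun f κ S).theory d ∈ T := by
  induction S using WellFoundedLT.induction with
  | ind S ih =>
  obtain rfl | hne := S.eq_empty_or_nonempty
  · exact hT.mem_of_subsingleton _
  obtain ⟨r, hr, hfr⟩ : ∃ r ∈ S, f r ∉ S := by
    by_contra! hclosed
    exact hne.ne_empty (hS S subset_rfl hclosed)
  have mem_of_subset (S' : Set V) (hsub : S' ⊆ S) (hrS' : r ∉ S') :
      (restrictFun f κ S').theory d ∈ T :=
    ih S' ⟨hsub, fun h => hrS' (h hr)⟩ fun M hM => hS M (hM.trans hsub)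
  refine hT.restrictFun_mem_of_basin (fun h => absurd h hfr)
    (hT.restrictFun_basin_mem hr id (fun _ _ => rfl) (fun _ => False) (fun x hx => ?_)
      (mem_of_subset _ (Set.sdiff_subset.trans (basin_subset f S r)) (by simp)))
    (mem_of_subset _ Set.sdiff_subset fun h => h.2 (mem_basin_self hr))
  rw [iff_false]
  rintro rfl
  exact hfr (basin_subset f S r hx.1)

theorem IsGlueClosed.restrictFun_mem_of_mapsTo [Finite V]
    {T : Set (Theory d ((K × Prop) × Prop))} (hT : IsGlueClosed.{u, v} d T)
    (hS : Set.MapsTo f S S) :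
    (restrictFun f (fun x => (κ x, False)) S).theory d ∈ T := by
  induction S using WellFoundedLT.induction with
  | ind S ih =>
  obtain rfl | hne := S.eq_empty_or_nonempty
  · exact hT.mem_of_subsingleton _
  obtain ⟨r, hr, hfr⟩ := exists_apply_mem_basin hS hne
  -- The cycle is cut at `r`; the mark on `f r` allows the edge leaving `r` to be restored.
  have forest_mem : (restrictFun f (fun x => (κ x, f r = x)) (basin f S r \ {r})).theory d ∈ T :=
    hT.restrictFun_mem_of_acyclic fun M => basin_sdiff_eq_empty_of_mapsTo
  have basin_mem : (restrictFun f (fun x => (κ x, False)) (basin f S r)).theory d ∈ T :=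
    hT.restrictFun_basin_mem hr (fun a => (a.1, False)) (fun _ _ => rfl) Prod.snd
      (fun _ _ => Iff.rfl) forest_mem
  have rest_mem : (restrictFun f (fun x => (κ x, False)) (S \ basin f S r)).theory d ∈ T :=
    ih _ ⟨Set.sdiff_subset, fun h => (h hr).2 (mem_basin_self hr)⟩ (mapsTo_sdiff_basin hS)
  exact hT.restrictFun_mem_of_basin (fun _ => hfr) basin_mem rest_mem

theorem exists_fin_theory_eq_ofFun [Finite V] [Finite K] (d : ℕ) (f : V → V) (κ : V → K) :
    ∃ n ≤ 2 ^ numTheories d (Nat.card ((K × Prop) × Prop)),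
      ∃ H : ColoredDigraph (Fin n) K, (ofFun f κ).theory d = H.theory d := by
  obtain ⟨k, hk, hT⟩ := exists_isGlueClosed_smallTheories.{u, v} d ((K × Prop) × Prop)
  obtain ⟨n, hn, H, hH⟩ :=
    hT.restrictFun_mem_of_mapsTo (f := f) (κ := κ) (Set.mapsTo_univ _ Set.univ)
  refine ⟨n, hn.trans (Nat.pow_le_pow_right two_pos hk), H.recolor fun a => a.1.1, ?_⟩
  rw [theory_recolor_eq hH]
  exact (theory_comap_equiv d (ofFun f κ) (Equiv.Set.univ V)).symm

section FunctionGraphs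

variable {W : Type w} {G : ColoredDigraph V K} {H : ColoredDigraph W K}

theorem exists_adj_of_theory_eq (hG : ∀ x, ∃ y, G.Adj x y) (h : G.theory 1 = H.theory 1) (y : W) :
    ∃ z, H.Adj y z := by
  obtain ⟨A, hA⟩ := (theory_succ_eq_iff.1 h).2 {y}
  obtain ⟨forth, back⟩ := theory_zero_eq_iff.1 hA
  obtain ⟨x, -, hx, -⟩ := back y y
  obtain ⟨x', hadj⟩ := hG x
  obtain ⟨y', z, hy', -, -, hadj_iff⟩ := forth x x'
  obtain rfl : y' = y := (congrArg Prod.snd (hy'.trans hx)).to_iff.2 rfl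
  exact ⟨z, hadj_iff.2 hadj⟩

theorem adj_unique_of_theory_eq (hG : ∀ x y z, G.Adj x y → G.Adj x z → y = z)
    (h : G.theory 2 = H.theory 2) {y z₁ z₂ : W} (h₁ : H.Adj y z₁) (h₂ : H.Adj y z₂) : z₁ = z₂ := by
  obtain ⟨A, hA⟩ := (theory_succ_eq_iff.1 h).2 {y}
  obtain ⟨A', hA'⟩ := (theory_succ_eq_iff.1 hA).2 {z₁}
  obtain ⟨forth, back⟩ := theory_zero_eq_iff.1 hA'
  obtain ⟨x₁, w₁, hx₁, hw₁, -, hadj₁⟩ := back y z₁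
  obtain ⟨x₂, w₂, hx₂, hw₂, -, hadj₂⟩ := back y z₂
  have A_eq : A = {x₁} := by
    refine forth.eq_singleton_of_color_eq (fun y x hyx => ?_) hx₁.symm rfl
    exact (congrArg (·.1.2) hyx).to_iff
  obtain rfl : x₂ = x₁ := by
    rw [← Set.mem_singleton_iff, ← A_eq]
    exact (congrArg (·.1.2) hx₂).to_iff.2 rfl
  obtain rfl : w₂ = w₁ := hG _ _ _ (hadj₂.2 h₂) (hadj₁.2 h₁)
  exact ((congrArg Prod.snd (hw₁.symm.trans hw₂)).to_iff.1 rfl).symm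

theorem exists_eq_ofFun (hG : ∀ x, ∃! y, G.Adj x y) : ∃ f, G = ofFun f G.color := by
  choose f hf huniq using hG
  have adj_iff (x y) : G.Adj x y ↔ f x = y := ⟨fun h => (huniq x y h).symm, fun h => h ▸ hf x⟩
  exact ⟨f, congrArg (mk · G.color) (Digraph.ext (funext₂ fun x y => propext (adj_iff x y)))⟩

theorem exists_fin_existsUnique_adj_theory_eq [Finite V] [Finite K] (d : ℕ)
    (hG : ∀ x, ∃! y, G.Adj x y) :
    ∃ n ≤ 2 ^ numTheories (d + 2) (Nat.card ((K × Prop) × Prop)),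
      ∃ H : ColoredDigraph (Fin n) K, (∀ x, ∃! y, H.Adj x y) ∧ G.theory d = H.theory d := by
  obtain ⟨f, hf⟩ := exists_eq_ofFun hG
  obtain ⟨n, hn, H, hGH⟩ := exists_fin_theory_eq_ofFun (d + 2) f G.color
  rw [← hf] at hGH
  have theory_two_eq : G.theory 2 = H.theory 2 := theory_eq_of_le (Nat.le_add_left 2 d) hGH
  refine ⟨n, hn, H, fun x => existsUnique_of_exists_of_unique ?_ fun y z => ?_,
    theory_eq_of_le (Nat.le_add_right d 2) hGH⟩
  · exact exists_adj_of_theory_eq (fun x => (hG x).exists)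
      (theory_eq_of_le one_le_two theory_two_eq) x
  · exact adj_unique_of_theory_eq (fun x _ _ => (hG x).unique) theory_two_eq

end FunctionGraphs

end ColoredDigraph

section Translation

open FirstOrder Language

variable {π : Type u} {V : Type v} {W : Type w} {j : ℕ}

namespace PFGraph

variable {X : PFGraph π V} {Y : PFGraph π W} {a : Fin j → X.BoolAssoc} {b : Fin j → Y.BoolAssoc}

instance (X : PFGraph π V) : Membership V X.BoolAssoc :=
  inferInstanceAs (Membership V (Set V))

/-- The coloured graph in which the colour of a vertex is the set of its colour names, a set of
colour names being encoded as a predicate. -/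
def toColoredDigraph (X : PFGraph π V) : ColoredDigraph V (π → Prop) where
  Adj := X.Adj
  color x p := x ∈ X.color p

/-- The inverse of `PFGraph.toColoredDigraph` on graphs with at most one outgoing edge at each
vertex. -/
def ofColoredDigraph (G : ColoredDigraph V (π → Prop))
    (hG : ∀ x y z, G.Adj x y → G.Adj x z → y = z) : PFGraph π V where
  Adj := G.Adj
  adj_unique := hG
  color p := {x | G.color x p}

/-- The coloured graph in which the colour of a vertex consists of its colour names and of the
indices of the sets in the tuple `a` that it belongs to. -/
def coloredBy (X : PFGraph π V) (a : Fin j → X.BoolAssoc) :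
    ColoredDigraph V ((π → Prop) × (Fin j → Prop)) where
  Adj := X.Adj
  color x := (X.toColoredDigraph.color x, fun i => x ∈ a i)

theorem coloredBy_snoc (X : PFGraph π V) (a : Fin j → X.BoolAssoc) (A : X.BoolAssoc) :
    X.coloredBy (Fin.snoc (α := fun _ => X.BoolAssoc) a A) =
      ((X.coloredBy a).expand A).recolor
        fun c => (c.1.1, Fin.snoc (α := fun _ => Prop) c.1.2 c.2) := by
  simp only [coloredBy, ColoredDigraph.expand, ColoredDigraph.recolor,
    ColoredDigraph.mk.injEq, true_and]
  funext x
  refine Prod.ext rfl (funext fun i => ?_)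
  induction i using Fin.lastCases with
  | last => simp only [Fin.snoc_last]; rfl
  | cast i => simp only [Fin.snoc_castSucc]

theorem coloredBy_of_fin_zero (X : PFGraph π V) (a : Fin 0 → X.BoolAssoc) :
    X.coloredBy a = X.toColoredDigraph.recolor fun c => (c, Fin.elim0) :=
  congrArg (ColoredDigraph.mk _) (funext fun _ => Prod.ext rfl (Subsingleton.elim _ _))

theorem mem_realize_iff_of_color_eq (t : (boolAssocLanguage π).Term (Fin j ⊕ Fin 0)) {x : V} {y : W}
    (hxy : (X.coloredBy a).color x = (Y.coloredBy b).color y) :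
    x ∈ t.realize (Sum.elim a default) ↔ y ∈ t.realize (Sum.elim b default) := by
  induction t with
  | var i =>
    rcases i with i | i
    · exact (congrFun (Prod.ext_iff.1 hxy).2 i).to_iff
    · exact i.elim0
  | func f ts ih =>
    simp only [Term.realize_func]
    change BoolAssocFunctions _ at f
    cases f with
    | bot => exact Iff.rfl
    | top => exact Iff.rfl
    | compl => exact not_congr (ih 0)
    | inf => exact and_congr (ih 0) (ih 1)
    | sup => exact or_congr (ih 0) (ih 1)

theorem IsFunctionGraph.notMem_orphan (hX : X.IsFunctionGraph) (x : V) : x ∉ X.orphan :=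
  fun hx => let ⟨y, hy, _⟩ := hX x; hx y hy

theorem IsFunctionGraph.realize_of_isAtomic (hX : X.IsFunctionGraph)
    (forth : (X.coloredBy a).PairForth (Y.coloredBy b))
    (back : (Y.coloredBy b).PairForth (X.coloredBy a)) {φ : (boolAssocLanguage π).Formula (Fin j)}
    (hφ : φ.IsAtomic) (hr : φ.Realize a) : φ.Realize b := by
  unfold Formula.Realize at hr ⊢
  cases hφ with
  | equal t₁ t₂ =>
    rw [BoundedFormula.realize_bdEqual] at hr ⊢
    exact back.eq_of_color_eq (fun _ _ => mem_realize_iff_of_color_eq t₁)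
      (fun _ _ => mem_realize_iff_of_color_eq t₂) hr
  | rel R ts =>
    rw [BoundedFormula.realize_rel] at hr ⊢
    have realize_eq_singleton (i) {x : V} {y : W}
        (hxy : (Y.coloredBy b).color y = (X.coloredBy a).color x)
        (hx : (ts i).realize (Sum.elim a default) = ({x} : Set V)) :
        (ts i).realize (Sum.elim b default) = ({y} : Set W) :=
      back.eq_singleton_of_color_eq (fun _ _ => mem_realize_iff_of_color_eq (ts i)) hxy.symm hx
    change BoolAssocRelations π _ at R
    cases R with
    | atomic =>
      obtain ⟨x, hx⟩ := hr
      obtain ⟨y, -, hy, -⟩ := forth x x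
      exact ⟨y, realize_eq_singleton 0 hy hx⟩
    | orphan =>
      obtain ⟨x, hx, -⟩ := hr
      exact absurd hx (hX.notMem_orphan x)
    | color p =>
      obtain ⟨x, hxp, hx⟩ := hr
      obtain ⟨y, -, hy, -⟩ := forth x x
      exact ⟨y, (congrFun (Prod.ext_iff.1 hy).1 p).to_iff.2 hxp, realize_eq_singleton 0 hy hx⟩
    | edge =>
      obtain ⟨x₁, x₂, hadj, hx₁, hx₂⟩ := hr
      obtain ⟨y₁, y₂, hy₁, hy₂, -, hadj_iff⟩ := forth x₁ x₂
      exact ⟨y₁, y₂, hadj_iff.2 hadj, realize_eq_singleton 0 hy₁ hx₁,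
        realize_eq_singleton 1 hy₂ hx₂⟩

theorem IsFunctionGraph.finiteTheory_eq (hX : X.IsFunctionGraph) (hY : Y.IsFunctionGraph) {d : ℕ}
    (h : (X.coloredBy a).theory d = (Y.coloredBy b).theory d) :
    finiteTheory (boolAssocLanguage π) d a = finiteTheory (boolAssocLanguage π) d b := by
  induction d generalizing j with
  | zero =>
    obtain ⟨forth, back⟩ := ColoredDigraph.theory_zero_eq_iff.1 h
    exact Set.ext fun φ => and_congr_right fun hφ =>
      ⟨hX.realize_of_isAtomic forth back hφ, hY.realize_of_isAtomic back forth hφ⟩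
  | succ d ih =>
    obtain ⟨forth, back⟩ := ColoredDigraph.theory_succ_eq_iff.1 h
    have snoc_eq {A : X.BoolAssoc} {B : Y.BoolAssoc}
        (hAB : ((X.coloredBy a).expand A).theory d = ((Y.coloredBy b).expand B).theory d) :
        finiteTheory (boolAssocLanguage π) d (Fin.snoc (α := fun _ => X.BoolAssoc) a A) =
          finiteTheory (boolAssocLanguage π) d (Fin.snoc (α := fun _ => Y.BoolAssoc) b B) := by
      apply ih
      rw [coloredBy_snoc, coloredBy_snoc]
      exact ColoredDigraph.theory_recolor_eq hAB _
    refine Set.Subset.antisymm (Set.range_subset_iff.2 fun A => ?_)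
      (Set.range_subset_iff.2 fun B => ?_)
    · exact (forth A).imp fun _ hAB => (snoc_eq hAB).symm
    · exact (back B).imp fun _ hAB => snoc_eq hAB

theorem IsFunctionGraph.msoTheory_eq (hX : X.IsFunctionGraph) (hY : Y.IsFunctionGraph) {d : ℕ}
    (h : X.toColoredDigraph.theory d = Y.toColoredDigraph.theory d) :
    X.msoTheory d = Y.msoTheory d := by
  apply hX.finiteTheory_eq hY
  rw [coloredBy_of_fin_zero, coloredBy_of_fin_zero]
  exact ColoredDigraph.theory_recolor_eq h _

end PFGraph

end Translation

theorem mainTheorem3 {π : Type*} [Finite π] :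
    ∃ F : ℕ → ℕ, Computable F ∧
      ∀ (d : ℕ) {V : Type*} [Finite V] (X : PFGraph π V), X.IsFunctionGraph →
        ∃ (W : Type) (_ : Finite W) (Y : PFGraph π W), Y.IsFunctionGraph ∧
          Nat.card W ≤ F d ∧ X.msoTheory d = Y.msoTheory d := by
  refine ⟨_, ColoredDigraph.computable_two_pow_numTheories 2
    (Nat.card (((π → Prop) × Prop) × Prop)), fun d V _ X hX => ?_⟩
  obtain ⟨n, hn, H, hH, theory_eq⟩ :=
    ColoredDigraph.exists_fin_existsUnique_adj_theory_eq (G := X.toColoredDigraph) d hX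
  let Y : PFGraph π (Fin n) := .ofColoredDigraph H fun x _ _ => (hH x).unique
  exact ⟨Fin n, inferInstance, Y, hH, (Nat.card_fin n).trans_le hn,
    hX.msoTheory_eq (Y := Y) hH theory_eq⟩
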